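/- Clauses are finite sets of literals, CNF formulas are finite sets of clauses, and the width of a clause is its number of literals. A CNF is a *hitting formula* if no clause contains two contrary literals and any two distinct clauses contain contrary literals (some $\ell$ in one and $\bar\ell$ in the other). A *Hitting refutation* of a CNF $F$ is an unsatisfiable hitting formula $H$ each of whose clauses contains a clause of $F$; its size is its number of clauses. A *tree-like resolution* refutation of $F$ is a tree deriving the empty clause from clauses of $F$ by the resolution rule (from $C\vee x$ and $D\vee\bar x$ infer $C\vee D$) and weakening (from $C$ infer $C\vee D$); its size is the number of nodes of the tree. For $f\colon\mathbb N\to\mathbb R$ write $g=\tilde O(f)$ if $g=O(f\log^{C}f)$, and $h=\tilde\Omega(f)$ if $h=\Omega(f/\log^{C}f)$, for some constant $C$. **Theorem.** For every $\varepsilon>0$ there is a sequence $(G_m)_{m\in\mathbb N}$ of unsatisfiable hitting formulas such that 1. $G_m$ has $2^{\tilde O(m)}$ clauses, all of width at most $\tilde O(m)$; 2. every tree-like resolution refutation of $G_m$ has size at least $2^{\tilde\Omega(m^{2-\varepsilon})}$; 3. consequently Hitting is quasi-polynomially separated from tree-like resolution: there are $s_m\to\infty$ such that $G_m$ has a Hitting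 refutation of size at most $s_m$, while for all sufficiently large $m$ every tree-like resolution refutation of $G_m$ has size at least $2^{(\log_2 s_m)^{2-\varepsilon}}$. -/

import Mathlib

namespace HittingSep

open Filter Asymptotics

/-- A propositional literal: `(x, true)` is the variable `x`, `(x, false)` is its negation. -/
abbrev Literal : Type := ℕ × Bool

/-- The contrary literal. -/
def Literal.neg (l : Literal) : Literal := (l.1, !l.2)

/-- A clause is a finite set of literals, read as their disjunction. -/
abbrev Clause : Type := Finset Literal

/-- A formula in conjunctive normal form is a finite set of clauses. -/
abbrev CNF : Type := Finset Clause

/-- The assignment `a` satisfies the clause `C`. -/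
def Clause.SatisfiedBy (C : Clause) (a : ℕ → Bool) : Prop := ∃ l ∈ C, a l.1 = l.2

/-- No assignment satisfies all clauses of `F`. -/
def CNF.Unsatisfiable (F : CNF) : Prop :=
  ∀ a : ℕ → Bool, ∃ C ∈ F, ¬ Clause.SatisfiedBy C a

/-- Two clauses conflict if one contains a literal whose contrary lies in the other. -/
def Clause.Conflict (C D : Clause) : Prop := ∃ l ∈ C, Literal.neg l ∈ D

/-- A hitting formula: any two of its clauses contain contrary literals. As usual, a clause of
such a formula does not itself contain two contrary literals. -/
def CNF.IsHitting (F : CNF) : Prop :=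
  (∀ C ∈ F, ¬ Clause.Conflict C C) ∧ ∀ C ∈ F, ∀ D ∈ F, C ≠ D → Clause.Conflict C D

/-- The width of a formula: the largest number of literals in one of its clauses. -/
def CNF.width (F : CNF) : ℕ := F.sup Finset.card

/-- `H` is a refutation of `F` in the proof system Hitting: an unsatisfiable hitting formula
each of whose clauses contains a clause of `F`. Its size is the number `H.card` of clauses. -/
def IsHittingRefutation (H F : CNF) : Prop :=
  CNF.IsHitting H ∧ CNF.Unsatisfiable H ∧ ∀ C ∈ H, ∃ C' ∈ F, C' ⊆ C

/-- Tree-like resolution derivations of a clause from the clauses of `F`, with the resolution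
rule (from `C ∨ x` and `D ∨ ¬x` derive `C ∨ D`) and the weakening rule. -/
inductive TreeRes (F : CNF) : Clause → Type
  | initial {C : Clause} (h : C ∈ F) : TreeRes F C
  | weaken {C D : Clause} (h : C ⊆ D) (p : TreeRes F C) : TreeRes F D
  | resolve {C D : Clause} (x : ℕ) (p : TreeRes F (insert (x, true) C))
      (q : TreeRes F (insert (x, false) D)) : TreeRes F (C ∪ D)

/-- The size of a tree-like derivation: the number of clauses (nodes) in the tree. -/
def TreeRes.size {F : CNF} : {C : Clause} → TreeRes F C → ℕ
  | _, .initial _ => 1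
  | _, .weaken _ p => p.size + 1
  | _, .resolve _ p q => p.size + q.size + 1

/-- A tree-like resolution refutation of `F` derives the empty clause. -/
abbrev TreeRefutation (F : CNF) : Type := TreeRes F ∅

/-- `g = Õ(f)`: `g = O(f log^C f)` for a constant `C`. -/
def TildeO (g f : ℕ → ℝ) : Prop :=
  ∃ C : ℕ, g =O[atTop] fun m => f m * Real.log (f m) ^ C

/-- `h = Ω̃(f)`: `h = Ω(f / log^C f)` for a constant `C`. (A genuine lower bound on `h`, not on
its absolute value.) -/
def TildeOmega (h f : ℕ → ℝ) : Prop :=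
  ∃ C : ℕ, ∃ c : ℝ, 0 < c ∧ ∀ᶠ m in atTop, c * (f m / Real.log (f m) ^ C) ≤ h m

end HittingSep

open HittingSep

namespace HittingSep

/-! ### Query measures: certificates, unambiguous certificates, adversaries -/

open Function

/-! Unambiguous certificates of a Boolean function partition the cube into subcubes, and the clauses
excluding these subcubes form an unsatisfiable hitting formula whose width is the certificate size
(`exists_formula`). The task is thus to find a function whose query complexity is nearly quadratic
in its unambiguous certificate size, and then to turn query depth into tree size.

Such functions come from iterating `f ↦ NOR ∘ cheat ∘ NOR ∘ f` (`Separated.step`). Each round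
multiplies the query complexity by `n ^ 2`, but the certificate sizes only by `n` and
polylogarithmic factors. The cheat sheet makes this possible: a cell of the input lists ordinary,
possibly ambiguous certificates, and reading the addressed cell is an unambiguous certificate for
one of the two values. After `k` rounds, the unambiguous size is about `n ^ (k + 1)` against query
complexity `n ^ (2 * k)`, and the exponent `2 * k / (k + 1)` tends to `2`.

Query lower bounds are kept as potential functions on partial assignments, which compose well.
Replacing each variable by a two-bit XOR turns a query adversary into a Delayer strategy
(`HasAdversary.xorLift`), and a Delayer earning `d` points forces tree-like size `2 ^ d`
(`TreeRes.two_pow_le_size`). -/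

/-- The total assignment `x` extends the partial assignment `ρ`. -/
def Extends {V : Type} (x : V → Bool) (ρ : V → Option Bool) : Prop :=
  ∀ v b, ρ v = some b → x v = b

/-- Some total assignment extending `ρ` gives `f` the value `b`. -/
def CanBe {V : Type} (f : (V → Bool) → Bool) (ρ : V → Option Bool) (b : Bool) : Prop :=
  ∃ x, Extends x ρ ∧ f x = b

/-- Every input `x` of `f` has a certificate of size at most `c (f x)`. -/
def HasCert {V : Type} (f : (V → Bool) → Bool) (c : Bool → ℕ) : Prop :=
  ∀ x, ∃ S : Finset V, S.card ≤ c (f x) ∧ ∀ y, (∀ v ∈ S, y v = x v) → f y = f x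

/-- `f` has unambiguous certificates, of size at most `u b` for the value `b`: the map `S` selects
the certificate of each input, and all inputs compatible with a certificate select it. -/
def HasUnamb {V : Type} (f : (V → Bool) → Bool) (u : Bool → ℕ) : Prop :=
  ∃ S : (V → Bool) → Finset V, (∀ x, (S x).card ≤ u (f x)) ∧
    ∀ x y, (∀ v ∈ S x, y v = x v) → f y = f x ∧ S y = S x

/-- An adversary, given by a potential function on partial assignments, that forces every decision
tree for `f` to make at least `d` queries. -/
def HasAdversary {V : Type} [DecidableEq V] (f : (V → Bool) → Bool) (d : ℕ) : Prop :=
  ∃ φ : (V → Option Bool) → ℕ, d ≤ φ (fun _ => none) ∧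
    (∀ ρ v, ρ v = none → ∃ b, φ ρ ≤ φ (update ρ v (some b)) + 1) ∧
    ∀ ρ, φ ρ ≠ 0 → ∀ b, CanBe f ρ b

theorem CanBe.exists_update {V : Type} [DecidableEq V] {f : (V → Bool) → Bool}
    {ρ : V → Option Bool} {b : Bool} (h : CanBe f ρ b) {v : V} :
    ∃ a, CanBe f (update ρ v (some a)) b := by
  obtain ⟨x, hx, hb⟩ := h
  refine ⟨x v, x, fun w a hw => ?_, hb⟩
  by_cases hwv : w = v
  · subst hwv; simpa using hw
  · rw [update_of_ne hwv] at hw; exact hx w a hw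

/-! ### Composition with NOR -/

section Nor

variable {V : Type} {n : ℕ}

/-- The composition of the `n`-bit NOR with `f`. -/
def nor (n : ℕ) (f : (V → Bool) → Bool) (x : Fin n × V → Bool) : Bool :=
  decide (∀ i, f (fun v => x (i, v)) = false)

theorem nor_eq_true {f : (V → Bool) → Bool} {x : Fin n × V → Bool} :
    nor n f x = true ↔ ∀ i, f (fun v => x (i, v)) = false := by simp [nor]

theorem nor_eq_false {f : (V → Bool) → Bool} {x : Fin n × V → Bool} :
    nor n f x = false ↔ ∃ i, f (fun v => x (i, v)) = true := by simp [nor]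

theorem HasCert.nor [DecidableEq V] {f : (V → Bool) → Bool} {c : Bool → ℕ} (h : HasCert f c)
    (n : ℕ) : HasCert (nor n f) (fun b => bif b then n * c false else c true) := by
  intro x
  rcases hx : HittingSep.nor n f x with _ | _
  · obtain ⟨i, hi⟩ := nor_eq_false.1 hx
    obtain ⟨S, hS, hy⟩ := h (fun v => x (i, v))
    rw [hi] at hS hy
    refine ⟨S.image (fun v => (i, v)), Finset.card_image_le.trans hS, fun y hyx => ?_⟩
    exact nor_eq_false.2 ⟨i, hy _ fun v hv => hyx _ (Finset.mem_image_of_mem _ hv)⟩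
  · have hi := nor_eq_true.1 hx
    choose S hS hy using fun i => h (fun v => x (i, v))
    refine ⟨Finset.univ.biUnion fun i => (S i).image (fun v => (i, v)), ?_, fun y hyx => ?_⟩
    · refine Finset.card_biUnion_le.trans ((Finset.sum_le_card_nsmul _ _ (c false) ?_).trans ?_)
      · intro i _
        exact Finset.card_image_le.trans ((hS i).trans (by rw [hi]))
      · simp
    · refine nor_eq_true.2 fun i => (hy i _ fun v hv => ?_).trans (hi i)
      exact hyx _ (Finset.mem_biUnion.2 ⟨i, Finset.mem_univ _, Finset.mem_image_of_mem _ hv⟩)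

/-- To be unambiguous, the certificate must single out the first block on which `f` is true: it
joins the block certificates up to and including that block, or all of them if there is none. -/
theorem HasUnamb.nor [DecidableEq V] {f : (V → Bool) → Bool} {u : Bool → ℕ} (h : HasUnamb f u)
    (n : ℕ) :
    HasUnamb (nor n f) (fun b => bif b then n * u false else n * u false + u true) := by
  obtain ⟨S, hS, hu⟩ := h
  let pre : (Fin n × V → Bool) → Fin n → Prop := fun x j => ∀ i < j, f (fun v => x (i, v)) = false
  let S' : (Fin n × V → Bool) → Finset (Fin n × V) := fun x =>
    Finset.univ.biUnion fun j =>
      if pre x j then (S (fun v => x (j, v))).image (fun v => (j, v)) else ∅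
  have hmem : ∀ x j v, pre x j → v ∈ S (fun v => x (j, v)) → (j, v) ∈ S' x := by
    intro x j v hj hv
    refine Finset.mem_biUnion.2 ⟨j, Finset.mem_univ _, ?_⟩
    rw [if_pos hj]
    exact Finset.mem_image_of_mem _ hv
  refine ⟨S', fun x => ?_, fun x y hxy => ?_⟩
  · rcases hx : HittingSep.nor n f x with _ | _
    · have hex := nor_eq_false.1 hx
      obtain ⟨i, hi, hmin⟩ : ∃ i, f (fun v => x (i, v)) = true ∧ pre x i := by
        obtain ⟨i, hi, hm⟩ := WellFounded.has_min (wellFounded_lt (α := Fin n))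
          {i | f (fun v => x (i, v)) = true} hex
        exact ⟨i, hi, fun j hj => by simpa using fun hh => hm j hh hj⟩
      have : ∀ j ∈ Finset.univ, (if pre x j then (S (fun v => x (j, v))).image
          (fun v => (j, v)) else ∅).card ≤ u false + if j = i then u true else 0 := by
        intro j _
        split_ifs with hp hji hji
        · subst hji
          exact Finset.card_image_le.trans ((hS _).trans (by rw [hi]; omega))
        · have : f (fun v => x (j, v)) = false := by
            rcases lt_trichotomy j i with hlt | heq | hgt
            · exact hmin j hlt
            · exact absurd heq hji
            · exact absurd (hp i hgt) (by simp [hi])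
          exact Finset.card_image_le.trans ((hS _).trans (by rw [this]; omega))
        · simp
        · simp
      refine Finset.card_biUnion_le.trans ((Finset.sum_le_sum this).trans ?_)
      simp [Finset.sum_add_distrib]
    · have hi := nor_eq_true.1 hx
      refine Finset.card_biUnion_le.trans ((Finset.sum_le_card_nsmul _ _ (u false) ?_).trans ?_)
      · intro j _
        split_ifs
        · exact Finset.card_image_le.trans ((hS _).trans (by rw [hi]))
        · simp
      · simp
  · have key : ∀ j, pre x j → f (fun v => y (j, v)) = f (fun v => x (j, v)) ∧
        S (fun v => y (j, v)) = S (fun v => x (j, v)) :=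
      fun j hj => hu _ _ fun v hv => hxy _ (hmem x j v hj hv)
    have hpre : ∀ j, pre y j ↔ pre x j := by
      intro j
      constructor
      -- Only this direction needs induction: `key` applies to a block once all earlier blocks of
      -- `x` are known to be false.
      · intro hy i hij
        induction i using WellFoundedLT.induction with
        | ind i ih =>
          rw [← (key i fun i' hi' => ih i' hi' (hi'.trans hij)).1]
          exact hy i hij
      · intro hx i hij
        rw [(key i fun i' hi' => hx i' (hi'.trans hij)).1]
        exact hx i hij
    constructor
    · have : HittingSep.nor n f y = true ↔ HittingSep.nor n f x = true := by
        rw [nor_eq_true, nor_eq_true]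
        constructor
        · intro hy i
          have hp : pre x i := (hpre i).1 fun j _ => hy j
          rw [← (key i hp).1]; exact hy i
        · intro hx i
          rw [(key i fun j _ => hx j).1]; exact hx i
      exact Bool.eq_iff_iff.2 this
    · refine Finset.biUnion_congr rfl fun j _ => ?_
      by_cases hp : pre x j
      · rw [if_pos hp, if_pos ((hpre j).2 hp), (key j hp).2]
      · rw [if_neg hp, if_neg (mt (hpre j).1 hp)]

/-- The adversary plays on each block separately, with the sum of the block potentials, and never
lets a block be forced to true. While some block has positive potential, that block alone decides
the NOR. -/
theorem HasAdversary.nor [DecidableEq V] {f : (V → Bool) → Bool} {d : ℕ} (h : HasAdversary f d)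
    (hf : CanBe f (fun _ => none) false) (n : ℕ) : HasAdversary (nor n f) (n * d) := by
  classical
  obtain ⟨φ, h0, hstep, hend⟩ := h
  let φ' : (Fin n × V → Option Bool) → ℕ := fun ρ =>
    if ∀ i, CanBe f (fun v => ρ (i, v)) false then ∑ i, φ (fun v => ρ (i, v)) else 0
  have hupd : ∀ (ρ : Fin n × V → Option Bool) i v a j,
      (fun w => update ρ (i, v) a (j, w)) =
        if j = i then update (fun w => ρ (i, w)) v a else fun w => ρ (j, w) := by
    intro ρ i v a j
    funext w
    by_cases hj : j = i
    · subst hj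
      by_cases hw : w = v
      · subst hw; simp
      · simp [hw]
    · simp [hj]
  refine ⟨φ', ?_, ?_, ?_⟩
  · simp only [φ', hf, implies_true, if_true]
    simpa using Nat.mul_le_mul_left n h0
  · rintro ρ ⟨i, v⟩ hv
    by_cases hall : ∀ i, CanBe f (fun v => ρ (i, v)) false
    · obtain ⟨b, hb, hc⟩ : ∃ b, φ (fun v => ρ (i, v)) ≤
          φ (update (fun v => ρ (i, v)) v (some b)) + 1 ∧
            CanBe f (update (fun v => ρ (i, v)) v (some b)) false := by
        -- With potential at least 2, the reply leaves it positive, so false stays possible.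
        -- Otherwise at most one point is at stake, and any reply keeping false possible will do.
        by_cases h2 : 2 ≤ φ (fun v => ρ (i, v))
        · obtain ⟨b, hb⟩ := hstep (fun v => ρ (i, v)) v hv
          exact ⟨b, hb, hend _ (by omega) _⟩
        · obtain ⟨b, hb⟩ := (hall i).exists_update (v := v)
          exact ⟨b, by omega, hb⟩
      refine ⟨b, ?_⟩
      have hall' : ∀ j, CanBe f (fun w => update ρ (i, v) (some b) (j, w)) false := by
        intro j
        rw [hupd]
        split_ifs
        · exact hc
        · exact hall j
      simp only [φ']
      rw [if_pos hall, if_pos hall', ← Finset.add_sum_erase _ _ (Finset.mem_univ i),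
        ← Finset.add_sum_erase _ (fun j => φ fun w => update ρ (i, v) (some b) (j, w))
          (Finset.mem_univ i)]
      have e1 : ∑ j ∈ Finset.univ.erase i, φ (fun w => update ρ (i, v) (some b) (j, w)) =
          ∑ j ∈ Finset.univ.erase i, φ (fun w => ρ (j, w)) := by
        refine Finset.sum_congr rfl fun j hj => ?_
        rw [hupd, if_neg (Finset.ne_of_mem_erase hj)]
      rw [e1, hupd, if_pos rfl]
      omega
    · exact ⟨true, by simp only [φ']; rw [if_neg hall]; omega⟩
  · intro ρ hρ b
    have hall : ∀ i, CanBe f (fun v => ρ (i, v)) false := by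
      by_contra hne
      exact hρ (if_neg hne)
    choose x hx hxf using hall
    cases b with
    | true => exact ⟨fun p => x p.1 p.2, fun p b hb => hx p.1 p.2 b hb, nor_eq_true.2 hxf⟩
    | false =>
      obtain ⟨i, -, hi⟩ : ∃ i ∈ Finset.univ, φ (fun v => ρ (i, v)) ≠ 0 := by
        apply Finset.exists_ne_zero_of_sum_ne_zero
        simp only [φ'] at hρ
        intro h0
        rw [h0] at hρ
        simp at hρ
      obtain ⟨z, hz, hzf⟩ := hend _ hi true
      refine ⟨fun p => if p.1 = i then z p.2 else x p.1 p.2, fun p b hb => ?_,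
        nor_eq_false.2 ⟨i, by simpa using hzf⟩⟩
      obtain ⟨j, w⟩ := p
      by_cases hj : j = i
      · subst hj; simpa using hz w b hb
      · simpa [hj] using hx j w b hb

end Nor

end HittingSep

namespace HittingSep

open Function

/-! ### Cheat sheet functions -/

section CheatSheet

variable {V : Type} {c C L : ℕ}

/-- The input variables of a cheat sheet function: `c` inputs for the base function, and for each
label `Fin c → Bool` a cell that encodes, for each of the `c` inputs, a list of at most `C`
variables, each written with `L` bits. -/
abbrev CheatVar (V : Type) (c C L : ℕ) : Type :=
  (Fin c × V) ⊕ ((Fin c → Bool) × Fin c × Fin C × Fin L)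

/-- The `i`-th base input. -/
def baseInput (x : CheatVar V c C L → Bool) (i : Fin c) : V → Bool := fun v => x (.inl (i, v))

/-- The label of an input: the address of the cell that counts. -/
def label (f : (V → Bool) → Bool) (x : CheatVar V c C L → Bool) : Fin c → Bool :=
  fun i => f (baseInput x i)

/-- The decoded contents of the cell with address `l`. -/
def cell (dec : (Fin L → Bool) → Option V) (x : CheatVar V c C L → Bool) (l : Fin c → Bool)
    (i : Fin c) (j : Fin C) : Option V :=
  dec fun t => x (.inr (l, i, j, t))

/-- The values of `x` on the listed variables determine the value of `f`. -/
def Certifies (f : (V → Bool) → Bool) (x : V → Bool) (P : Fin C → Option V) :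
    Prop :=
  ∀ y, (∀ j, ∀ v ∈ P j, y v = x v) → f y = f x

open Classical in
/-- The negated cheat sheet function: it is `false` when the cell addressed by the label lists
certificates for all base inputs. -/
noncomputable def cheat (f : (V → Bool) → Bool) (dec : (Fin L → Bool) → Option V)
    (x : CheatVar V c C L → Bool) : Bool :=
  !decide (∀ i, Certifies f (baseInput x i) (cell dec x (label f x) i))

theorem cheat_eq_false {f : (V → Bool) → Bool} {dec : (Fin L → Bool) → Option V}
    {x : CheatVar V c C L → Bool} :
    cheat f dec x = false ↔ ∀ i, Certifies f (baseInput x i) (cell dec x (label f x) i) := by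
  simp [cheat]

theorem Certifies.congr {f : (V → Bool) → Bool} {x y : V → Bool} {P : Fin C → Option V}
    (hf : f y = f x) (hP : ∀ j, ∀ v ∈ P j, y v = x v) : Certifies f y P ↔ Certifies f x P := by
  unfold Certifies
  refine forall_congr' fun z => ?_
  rw [hf]
  refine imp_congr_left (forall_congr' fun j => forall₂_congr fun v hv => ?_)
  rw [hP j v hv]

variable [DecidableEq V]

/-- The variables of the addressed cell and the base variables that it lists. -/
def cellVars (f : (V → Bool) → Bool) (dec : (Fin L → Bool) → Option V) (x : CheatVar V c C L → Bool) :
    Finset (CheatVar V c C L) :=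
  (Finset.univ.image fun p : Fin c × Fin C × Fin L => Sum.inr (label f x, p)) ∪
    Finset.univ.biUnion fun p : Fin c × Fin C =>
      (cell dec x (label f x) p.1 p.2).toFinset.image fun v => Sum.inl (p.1, v)

theorem card_cellVars_le (f : (V → Bool) → Bool) (dec : (Fin L → Bool) → Option V)
    (x : CheatVar V c C L → Bool) : (cellVars f dec x).card ≤ C * (c * (L + 1)) := by
  refine (Finset.card_union_le _ _).trans
    ((Nat.add_le_add Finset.card_image_le (Finset.card_biUnion_le.trans
      (Finset.sum_le_card_nsmul _ _ 1 fun p _ => Finset.card_image_le.trans ?_))).trans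
        (le_of_eq ?_))
  · cases cell dec x (label f x) p.1 p.2 <;> simp
  · simp
    ring

/-- The copies of the sets `T i` in the base variables. -/
def baseVars (L C : ℕ) (T : Fin c → Finset V) : Finset (CheatVar V c C L) :=
  Finset.univ.biUnion fun i => (T i).image fun v => Sum.inl (i, v)

theorem card_baseVars_le {T : Fin c → Finset V} {U : ℕ} (h : ∀ i, (T i).card ≤ U) :
    (baseVars L C T).card ≤ c * U := by
  refine Finset.card_biUnion_le.trans ((Finset.sum_le_card_nsmul _ _ U ?_).trans (by simp))
  exact fun i _ => Finset.card_image_le.trans (h i)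

theorem mem_baseVars {T : Fin c → Finset V} {i : Fin c} {v : V} (h : v ∈ T i) :
    (Sum.inl (i, v) : CheatVar V c C L) ∈ baseVars L C T :=
  Finset.mem_biUnion.2 ⟨i, Finset.mem_univ _, Finset.mem_image_of_mem _ h⟩

section agree

variable {f : (V → Bool) → Bool} {dec : (Fin L → Bool) → Option V} {x y : CheatVar V c C L → Bool}

theorem cell_eq_of_agree (h : ∀ v ∈ cellVars f dec x, y v = x v) :
    cell dec y (label f x) = cell dec x (label f x) := by
  funext i j
  unfold cell
  congr 1
  funext t
  exact h _ (Finset.mem_union_left _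
    (Finset.mem_image_of_mem (fun p : Fin c × Fin C × Fin L =>
      (Sum.inr (label f x, p) : CheatVar V c C L)) (Finset.mem_univ (i, j, t))))

theorem baseInput_eq_of_agree (h : ∀ v ∈ cellVars f dec x, y v = x v) (i : Fin c) (j : Fin C)
    (v : V) (hv : v ∈ cell dec x (label f x) i j) : baseInput y i v = baseInput x i v :=
  h _ (Finset.mem_union_right _ (Finset.mem_biUnion.2 ⟨(i, j), Finset.mem_univ _,
    Finset.mem_image_of_mem _ (Option.mem_toFinset.2 hv)⟩))

/-- The cell is self-certifying: when its lists are valid, the listed values already force every bit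
of the address under which it was found. -/
theorem label_eq_of_agree (hx : cheat f dec x = false)
    (h : ∀ v ∈ cellVars f dec x, y v = x v) : label f y = label f x :=
  funext fun i => cheat_eq_false.1 hx i _ (baseInput_eq_of_agree h i)

theorem cheat_eq_of_agree (hl : label f y = label f x)
    (h : ∀ v ∈ cellVars f dec x, y v = x v) :
    cheat f dec y = cheat f dec x ∧ cellVars f dec y = cellVars f dec x := by
  have hc := cell_eq_of_agree h
  constructor
  · have : cheat f dec y = false ↔ cheat f dec x = false := by
      rw [cheat_eq_false, cheat_eq_false, hl, hc]
      exact forall_congr' fun i => Certifies.congr (congrFun hl i) (baseInput_eq_of_agree h i)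
    rcases hx : cheat f dec x with _ | _
    · exact this.2 hx
    · by_contra hy
      simp only [Bool.not_eq_true] at hy
      rw [this.1 hy] at hx
      cases hx
  · unfold cellVars
    rw [hl, hc]

end agree

theorem HasCert.cheat {f : (V → Bool) → Bool} {a : Bool → ℕ} (h : HasCert f a) {A : ℕ}
    (ha : ∀ b, a b ≤ A) (c C : ℕ) (dec : (Fin L → Bool) → Option V) :
    HasCert (cheat (c := c) (C := C) f dec)
      (fun b => bif b then c * A + C * (c * (L + 1)) else C * (c * (L + 1))) := by
  intro x
  rcases hx : HittingSep.cheat f dec x with _ | _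
  · refine ⟨cellVars f dec x, card_cellVars_le f dec x, fun y hy => ?_⟩
    rw [(cheat_eq_of_agree (label_eq_of_agree hx hy) hy).1, hx]
  · choose T hT hTy using fun i => h (baseInput x i)
    refine ⟨baseVars L C T ∪ cellVars f dec x, (Finset.card_union_le _ _).trans
      (Nat.add_le_add (card_baseVars_le fun i => (hT i).trans (ha _)) (card_cellVars_le f dec x)),
      fun y hy => ?_⟩
    have hl : label f y = label f x := funext fun i => hTy i _ fun v hv =>
      hy _ (Finset.mem_union_left _ (mem_baseVars hv))
    rw [(cheat_eq_of_agree hl fun v hv => hy v (Finset.mem_union_right _ hv)).1, hx]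

/-- For the value `false`, the address picks a single cell and so a single certificate, even if the
listed ones are ambiguous. Only the value `true` needs unambiguous certificates of the base inputs,
to fix the address. -/
theorem HasUnamb.cheat {f : (V → Bool) → Bool} {u : Bool → ℕ} (h : HasUnamb f u) {U : ℕ}
    (hU : ∀ b, u b ≤ U) (c C : ℕ) (dec : (Fin L → Bool) → Option V) :
    HasUnamb (cheat (c := c) (C := C) f dec)
      (fun b => bif b then c * U + C * (c * (L + 1)) else C * (c * (L + 1))) := by
  obtain ⟨S, hS, hu⟩ := h
  refine ⟨fun x => if HittingSep.cheat f dec x = true then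
    baseVars L C (fun i => S (baseInput x i)) ∪ cellVars f dec x else cellVars f dec x,
    fun x => ?_, fun x y hxy => ?_⟩
  · rcases hx : HittingSep.cheat f dec x with _ | _
    · simpa [hx] using card_cellVars_le f dec x
    · simpa [hx] using (Finset.card_union_le _ _).trans
        (Nat.add_le_add (card_baseVars_le fun i => (hS _).trans (hU _))
          (card_cellVars_le f dec x))
  · rcases hx : HittingSep.cheat f dec x with _ | _
    · simp only [hx, Bool.false_eq_true, if_false] at hxy ⊢
      obtain ⟨h1, h2⟩ := cheat_eq_of_agree (label_eq_of_agree hx hxy) hxy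
      rw [h1, hx]
      simp [h2]
    · simp only [hx, if_true] at hxy ⊢
      have hb : ∀ i, f (baseInput y i) = f (baseInput x i) ∧
          S (baseInput y i) = S (baseInput x i) := fun i => hu _ _ fun v hv =>
        hxy _ (Finset.mem_union_left _ (mem_baseVars (T := fun i => S (baseInput x i)) hv))
      obtain ⟨h1, h2⟩ := cheat_eq_of_agree (funext fun i => (hb i).1)
        fun v hv => hxy v (Finset.mem_union_right _ hv)
      rw [h1, hx]
      simp [h2, hb]

omit [DecidableEq V] in
theorem exists_certifies {f : (V → Bool) → Bool} {a : Bool → ℕ} (h : HasCert f a)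
    (ha : ∀ b, a b ≤ C) (x : V → Bool) : ∃ P : Fin C → Option V, Certifies f x P := by
  obtain ⟨S, hS, hy⟩ := h x
  have hc : S.card ≤ C := hS.trans (ha _)
  refine ⟨fun j => if hj : (j : ℕ) < S.card then some (S.equivFin.symm ⟨j, hj⟩).1 else none,
    fun y hyx => hy y fun v hv => ?_⟩
  exact hyx ⟨S.equivFin ⟨v, hv⟩, (Fin.is_lt _).trans_le hc⟩ v (by simp)

/-- While all base inputs are undetermined and some cell is untouched, the address can still be
steered to that cell, whose contents are free. Exhausting the `2 ^ c` cells costs at least `d`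
queries. -/
theorem HasAdversary.cheat {f : (V → Bool) → Bool} {d : ℕ} (h : HasAdversary f d)
    {a : Bool → ℕ} (hc : HasCert f a) (ha : ∀ b, a b ≤ C) (hc0 : 0 < c) (hd : d ≤ 2 ^ c)
    {dec : (Fin L → Bool) → Option V} (hdec : Surjective dec) :
    HasAdversary (cheat (c := c) (C := C) f dec) d := by
  classical
  obtain ⟨φ, h0, hstep, hend⟩ := h
  let touched : (CheatVar V c C L → Option Bool) → Finset (Fin c → Bool) := fun ρ =>
    Finset.univ.filter fun l => ∃ p, ρ (.inr (l, p)) ≠ none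
  let base : (CheatVar V c C L → Option Bool) → Fin c → V → Option Bool := fun ρ i v =>
    ρ (.inl (i, v))
  have : Nonempty (Fin c) := ⟨⟨0, hc0⟩⟩
  -- A base query lowers one `φ` by at most 1, and a cell query touches at most one new cell, so the
  -- minimum drops by at most 1.
  let ψ : (CheatVar V c C L → Option Bool) → ℕ := fun ρ =>
    min (Finset.univ.inf' Finset.univ_nonempty fun i => φ (base ρ i)) (2 ^ c - (touched ρ).card)
  have le_ψ : ∀ ρ k, k ≤ ψ ρ ↔ (∀ i, k ≤ φ (base ρ i)) ∧ k ≤ 2 ^ c - (touched ρ).card := by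
    intro ρ k
    simp [ψ]
  refine ⟨ψ, ?_, ?_, ?_⟩
  · refine (le_ψ (fun _ => none) _).2 ⟨fun _ => h0, ?_⟩
    simpa [touched] using hd
  · intro ρ v hv
    obtain ⟨hψ1, hψ2⟩ := (le_ψ ρ _).1 le_rfl
    suffices ∃ b, ψ ρ - 1 ≤ ψ (update ρ v (some b)) by
      obtain ⟨b, hb⟩ := this; exact ⟨b, by omega⟩
    rcases v with ⟨i, v⟩ | ⟨l, p⟩
    · obtain ⟨b, hb⟩ := hstep (base ρ i) v hv
      refine ⟨b, (le_ψ _ _).2 ⟨fun j => ?_, ?_⟩⟩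
      · by_cases hj : j = i
        · subst hj
          have : base (update ρ (.inl (j, v)) (some b)) j = update (base ρ j) v (some b) := by
            funext w
            by_cases hw : w = v
            · subst hw; simp [base]
            · simp [base, hw]
          rw [this]
          have := hψ1 j
          omega
        · have : base (update ρ (.inl (i, v)) (some b)) j = base ρ j := by
            funext w; simp [base, hj]
          rw [this]
          have := hψ1 j
          omega
      · have : touched (update ρ (.inl (i, v)) (some b)) = touched ρ := by simp [touched]
        rw [this]
        omega
    · refine ⟨true, (le_ψ _ _).2 ⟨fun j => ?_, ?_⟩⟩
      · have : base (update ρ (.inr (l, p)) (some true)) j = base ρ j := by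
          funext w; simp [base]
        rw [this]
        have := hψ1 j
        omega
      · have : touched (update ρ (.inr (l, p)) (some true)) ⊆ insert l (touched ρ) := by
          intro l' hl'
          simp only [touched, Finset.mem_filter, Finset.mem_univ, true_and, Finset.mem_insert]
            at hl' ⊢
          obtain ⟨p', hp'⟩ := hl'
          by_cases hll : l' = l
          · exact .inl hll
          · refine .inr ⟨p', ?_⟩
            rwa [update_of_ne (by simp [hll])] at hp'
        have := (Finset.card_le_card this).trans (Finset.card_insert_le _ _)
        omega
  · intro ρ hρ b
    obtain ⟨h1, h2⟩ := (le_ψ ρ 1).1 (Nat.one_le_iff_ne_zero.2 hρ)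
    obtain ⟨l, hl⟩ : ∃ l, l ∉ touched ρ := by
      by_contra! hall
      rw [Finset.eq_univ_iff_forall.2 hall] at h2
      simp at h2
    have hl' : ∀ p, ρ (.inr (l, p)) = none := by simpa [touched] using hl
    choose x hx hxl using fun i => hend _ (Nat.one_le_iff_ne_zero.1 (h1 i)) (l i)
    have hcan : ∀ P : Fin c → Fin C → Option V, ∃ z : CheatVar V c C L → Bool, Extends z ρ ∧
        (∀ i, baseInput z i = x i) ∧ cell dec z l = P := by
      intro P
      choose q hq using fun v => hdec v
      refine ⟨fun v => match v with
        | .inl (i, v) => x i v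
        | .inr (l', i, j, t) => if l' = l then q (P i j) t else (ρ (.inr (l', i, j, t))).getD true,
        ?_, fun i => rfl, ?_⟩
      · rintro (⟨i, v⟩ | ⟨l', i, j, t⟩) b hb
        · exact hx i v b hb
        · have : l' ≠ l := by
            rintro rfl
            rw [hl'] at hb
            cases hb
          simp [this, hb]
      · funext i j
        simp [cell, hq]
    have hlab : ∀ z : CheatVar V c C L → Bool, (∀ i, baseInput z i = x i) → label f z = l :=
      fun z hz => funext fun i => by rw [label, hz, hxl]
    cases b with
    | false =>
      choose P hP using fun i => exists_certifies hc ha (x i)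
      obtain ⟨z, hz, hzx, hzP⟩ := hcan P
      refine ⟨z, hz, cheat_eq_false.2 fun i => ?_⟩
      rw [hlab z hzx, hzP, hzx]
      exact hP i
    | true =>
      -- An empty list certifies nothing, as `f` is not constant.
      obtain ⟨z, hz, hzx, hzP⟩ := hcan fun _ _ => none
      refine ⟨z, hz, ?_⟩
      by_contra hne
      have i : Fin c := ⟨0, hc0⟩
      have hcert := cheat_eq_false.1 (Bool.not_eq_true _ ▸ hne) i
      obtain ⟨y, -, hy⟩ := hend _ (Nat.one_le_iff_ne_zero.1 (h1 i)) (!(f (x i)))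
      rw [hlab z hzx, hzP, hzx] at hcert
      have := hcert y (by simp)
      rw [hy] at this
      simp at this

end CheatSheet

end HittingSep

namespace HittingSep

open Function

/-! ### From query adversaries to Delayer strategies -/

section Lift

variable {V : Type}

/-- A strategy for the Delayer in the Prover-Delayer game for `f`, given by a potential function
on partial assignments, that earns `d` points. -/
def HasDelayer [DecidableEq V] (f : (V → Bool) → Bool) (d : ℕ) : Prop :=
  ∃ φ : (V → Option Bool) → ℕ, d ≤ φ (fun _ => none) ∧
    (∀ ρ v, ρ v = none → (∃ b, φ ρ ≤ φ (update ρ v (some b))) ∨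
      ∀ b, φ ρ ≤ φ (update ρ v (some b)) + 1) ∧
    ∀ ρ, φ ρ ≠ 0 → ∀ b, CanBe f ρ b

/-- The composition of `f` with a two-bit XOR in place of each variable. -/
def xorLift (f : (V → Bool) → Bool) (x : V × Bool → Bool) : Bool :=
  f fun v => xor (x (v, false)) (x (v, true))

theorem HasUnamb.xorLift [DecidableEq V] {f : (V → Bool) → Bool} {u : Bool → ℕ}
    (h : HasUnamb f u) : HasUnamb (xorLift f) (fun b => u b * 2) := by
  obtain ⟨S, hS, hu⟩ := h
  refine ⟨fun x => S (fun v => xor (x (v, false)) (x (v, true))) ×ˢ Finset.univ, fun x => ?_,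
    fun x y hxy => ?_⟩
  · simpa [HittingSep.xorLift] using hS _
  · obtain ⟨h1, h2⟩ := hu (fun v => xor (x (v, false)) (x (v, true)))
      (fun v => xor (y (v, false)) (y (v, true))) fun v hv => by
        rw [hxy (v, false) (by simp [hv]), hxy (v, true) (by simp [hv])]
    exact ⟨h1, by simp only [h2]⟩

/-- The partial assignment of the XORs that are determined. -/
def xorPart (ρ : V × Bool → Option Bool) (v : V) : Option Bool :=
  match ρ (v, false), ρ (v, true) with
  | some a, some b => some (xor a b)
  | _, _ => none

theorem CanBe.xorLift {f : (V → Bool) → Bool} {ρ : V × Bool → Option Bool} {b : Bool}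
    (h : CanBe f (xorPart ρ) b) : CanBe (xorLift f) ρ b := by
  obtain ⟨x, hx, hb⟩ := h
  have : ∀ v, ∃ a : Bool → Bool, (∀ i, ∀ c, ρ (v, i) = some c → a i = c) ∧
      xor (a false) (a true) = x v := by
    intro v
    have hxv := hx v
    rcases h0 : ρ (v, false) with _ | a0
    · refine ⟨fun i => bif i then (ρ (v, true)).getD true else
        xor (x v) ((ρ (v, true)).getD true), ?_, by simp⟩
      rintro (_ | _) c hc
      · simp [h0] at hc
      · simp [hc]
    · refine ⟨fun i => bif i then xor (x v) a0 else a0, ?_, by cases x v <;> cases a0 <;> rfl⟩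
      rintro (_ | _) c hc
      · rw [h0] at hc; simpa using hc
      · rw [hxv (xor a0 c) (by simp [xorPart, h0, hc])]
        cases a0 <;> cases c <;> rfl
  choose a ha hax using this
  exact ⟨fun p => a p.1 p.2, fun p c hc => ha p.1 p.2 c hc, by simp [HittingSep.xorLift, hax, hb]⟩

/-- The first bit of a pair leaves its XOR open, so the Delayer lets the Prover choose and scores a
point. The second bit then realizes the adversary's reply. Subtracting the number of half-queried
pairs charges the point to the first bit, so the second one costs nothing. -/
theorem HasAdversary.xorLift [DecidableEq V] [Fintype V] {f : (V → Bool) → Bool} {d : ℕ}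
    (h : HasAdversary f d) : HasDelayer (xorLift f) d := by
  obtain ⟨φ, h0, hstep, hend⟩ := h
  let half : (V × Bool → Option Bool) → Finset V := fun ρ =>
    Finset.univ.filter fun v => (ρ (v, false)).isSome ≠ (ρ (v, true)).isSome
  refine ⟨fun ρ => φ (xorPart ρ) - (half ρ).card, ?_, ?_, ?_⟩
  · have : xorPart (fun _ : V × Bool => none) = fun _ => none := by funext v; simp [xorPart]
    simpa [this, half] using h0
  · rintro ρ ⟨v, i⟩ hv
    have hne : ∀ (b : Bool) (w : V), w ≠ v → ∀ j, update ρ (v, i) (some b) (w, j) = ρ (w, j) :=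
      fun b w hw j => update_of_ne (by simp [hw]) _ _
    have hother : ∀ b : Bool, update ρ (v, i) (some b) (v, !i) = ρ (v, !i) := fun b =>
      update_of_ne (by simp) _ _
    rcases ho : ρ (v, !i) with _ | o
    · right
      intro b
      have h1 : xorPart (update ρ (v, i) (some b)) = xorPart ρ := by
        funext w
        by_cases hw : w = v
        · subst hw
          have := hother b
          cases i <;> simp_all [xorPart]
        · simp only [xorPart, hne b w hw]
      have h2 : half (update ρ (v, i) (some b)) ⊆ insert v (half ρ) := by
        intro w hw
        by_cases hwv : w = v
        · simp [hwv]
        · simpa [half, hne b w hwv, hwv] using hw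
      have h3 := (Finset.card_le_card h2).trans (Finset.card_insert_le _ _)
      simp only [h1]
      omega
    · left
      have hnone : xorPart ρ v = none := by cases i <;> simp_all [xorPart]
      obtain ⟨b, hb⟩ := hstep (xorPart ρ) v hnone
      refine ⟨xor b o, ?_⟩
      have h1 : xorPart (update ρ (v, i) (some (xor b o))) = update (xorPart ρ) v (some b) := by
        funext w
        by_cases hw : w = v
        · subst hw
          have := hother (xor b o)
          cases i <;> simp_all [xorPart]
          all_goals cases b <;> cases o <;> rfl
        · simp only [xorPart, hne _ w hw, update_of_ne hw]
      have hmem : v ∈ half ρ := by cases i <;> simp_all [half]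
      have h2 : half (update ρ (v, i) (some (xor b o))) ⊆ (half ρ).erase v := by
        intro w hw
        by_cases hwv : w = v
        · subst hwv
          have := hother (xor b o)
          cases i <;> simp_all [half]
        · simpa [half, hne _ w hwv, hwv] using hw
      have h3 := Finset.card_le_card h2
      rw [Finset.card_erase_of_mem hmem] at h3
      have h4 : 0 < (half ρ).card := Finset.card_pos.2 ⟨v, hmem⟩
      simp only [h1]
      omega
  · intro ρ hρ b
    exact (hend _ (fun h => hρ (by simp [h])) b).xorLift

end Lift

/-! ### Tree-like lower bound and the hitting formula of a function -/

section Formula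

/-- The partial assignment `ρ` falsifies all literals of `C`. -/
def Clause.FalsifiedBy (C : Clause) (ρ : ℕ → Option Bool) : Prop :=
  ∀ l ∈ C, ρ l.1 = some (!l.2)

/-- Induction on the derivation, walking from its conclusion towards the initial clauses and keeping
the current clause falsified by `ρ`. At an unassigned pivot, either one premise retains the full
potential, or both retain it up to 1 and `2 ^ (φ ρ - 1)` counts twice. -/
theorem TreeRes.two_pow_le_size {F : CNF} (φ : (ℕ → Option Bool) → ℕ)
    (hstep : ∀ ρ v, ρ v = none → (∃ b, φ ρ ≤ φ (update ρ v (some b))) ∨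
      ∀ b, φ ρ ≤ φ (update ρ v (some b)) + 1)
    (hend : ∀ ρ, φ ρ ≠ 0 → ∀ C ∈ F, ¬ C.FalsifiedBy ρ) {C : Clause} (p : TreeRes F C) :
    ∀ ρ, C.FalsifiedBy ρ → 2 ^ φ ρ ≤ p.size := by
  induction p with
  | @initial C h =>
    intro ρ hC
    have : φ ρ = 0 := by
      by_contra hne
      exact hend ρ hne C h hC
    simp [this, TreeRes.size]
  | weaken h p ih =>
    intro ρ hC
    exact (ih ρ fun l hl => hC l (h hl)).trans (Nat.le_succ _)
  | @resolve C D x p q ihp ihq =>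
    intro ρ hCD
    have hsub : ∀ (E : Clause) (ρ' : ℕ → Option Bool) (b : Bool), E ⊆ C ∪ D →
        (∀ v a, ρ v = some a → ρ' v = some a) → ρ' x = some (!b) →
          Clause.FalsifiedBy (insert (x, b) E) ρ' := by
      intro E ρ' b hE hρ' hx l hl
      rcases Finset.mem_insert.1 hl with rfl | hl
      · exact hx
      · exact hρ' _ _ (hCD l (hE hl))
    simp only [TreeRes.size]
    rcases hx : ρ x with _ | a
    · have hext : ∀ b v a, ρ v = some a → update ρ x (some b) v = some a := by
        intro b v a hv
        rwa [update_of_ne]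
        rintro rfl
        simp [hx] at hv
      have h1 := ihp (update ρ x (some false))
        (hsub C _ true Finset.subset_union_left (hext _) (by simp))
      have h2 := ihq (update ρ x (some true))
        (hsub D _ false Finset.subset_union_right (hext _) (by simp))
      rcases hstep ρ x hx with ⟨b, hb⟩ | hb
      · have h3 := Nat.pow_le_pow_right (n := 2) (by norm_num) hb
        cases b <;> omega
      · have hf := Nat.pow_le_pow_right (n := 2) (by norm_num) (hb false)
        have ht := Nat.pow_le_pow_right (n := 2) (by norm_num) (hb true)
        rw [pow_succ] at hf ht
        omega
    · cases a
      · have := ihp ρ (hsub C ρ true Finset.subset_union_left (fun _ _ h => h) hx)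
        omega
      · have := ihq ρ (hsub D ρ false Finset.subset_union_right (fun _ _ h => h) hx)
        omega

variable {V : Type}

/-- The clause that excludes the inputs that agree with `x` on `S`. -/
def exclude (e : V → ℕ) (S : Finset V) (x : V → Bool) : Clause :=
  S.image fun v => (e v, !x v)

theorem mem_exclude {e : V → ℕ} {S : Finset V} {x : V → Bool} {l : Literal} :
    l ∈ exclude e S x ↔ ∃ v ∈ S, (e v, !x v) = l := Finset.mem_image

/-- A volume argument: each clause comes from at least a `2 ^ (-w)` fraction of the cube, and
distinct clauses come from disjoint sets of inputs. -/
theorem card_image_exclude_le [Fintype V] [DecidableEq V] (e : V → ℕ)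
    {S : (V → Bool) → Finset V} {w : ℕ} (hw : ∀ x, (S x).card ≤ w)
    (hS : ∀ x y, (∀ v ∈ S x, y v = x v) → S y = S x) :
    (Finset.univ.image fun x => exclude e (S x) x).card ≤ 2 ^ w := by
  classical
  have hfib : ∀ C ∈ Finset.univ.image (fun x => exclude e (S x) x), 2 ^ Fintype.card V ≤
      (Finset.univ.filter fun x => exclude e (S x) x = C).card * 2 ^ w := by
    intro C hC
    obtain ⟨x, -, rfl⟩ := Finset.mem_image.1 hC
    -- Overwriting `y` by `x` on `S x` lands in the fiber; the second component remembers the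
    -- overwritten bits.
    let g : (V → Bool) → {y // exclude e (S y) y = exclude e (S x) x} × (S x → Bool) := fun y =>
      (⟨fun v => if v ∈ S x then x v else y v, by
        have h1 : S (fun v => if v ∈ S x then x v else y v) = S x :=
          hS x _ fun v hv => if_pos hv
        rw [h1]
        refine Finset.image_congr fun v hv => ?_
        simp [Finset.mem_coe.1 hv]⟩, fun v => y v)
    have hg : Injective g := by
      intro y z hyz
      funext v
      simp only [g, Prod.mk.injEq, Subtype.mk.injEq] at hyz
      by_cases hv : v ∈ S x
      · exact congrFun hyz.2 ⟨v, hv⟩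
      · simpa [hv] using congrFun hyz.1 v
    have := Fintype.card_le_of_injective g hg
    rw [Fintype.card_prod, Fintype.card_subtype] at this
    simp only [Fintype.card_fun, Fintype.card_bool, Fintype.card_coe] at this
    exact this.trans (Nat.mul_le_mul_left _ (Nat.pow_le_pow_right (by norm_num) (hw x)))
  have hsum := Finset.card_eq_sum_card_image (fun x => exclude e (S x) x)
    (Finset.univ : Finset (V → Bool))
  rw [Finset.card_univ, Fintype.card_fun, Fintype.card_bool] at hsum
  have h2 := Finset.card_nsmul_le_sum _ _ _ hfib
  rw [← Finset.sum_mul, ← hsum, smul_eq_mul, mul_comm] at h2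
  exact Nat.le_of_mul_le_mul_left h2 (by positivity)

theorem exists_formula [Fintype V] [DecidableEq V] {f : (V → Bool) → Bool} {u : Bool → ℕ}
    {w d : ℕ} (h : HasUnamb f u) (hu : ∀ b, u b ≤ w) (hd : HasDelayer f d) :
    ∃ F : CNF, F.IsHitting ∧ F.Unsatisfiable ∧ F.width ≤ w ∧ F.card ≤ 2 ^ w ∧
      ∀ p : TreeRefutation F, 2 ^ d ≤ p.size := by
  obtain ⟨S, hS, hun⟩ := h
  obtain ⟨φ, h0, hstep, hend⟩ := hd
  obtain ⟨e, he⟩ : ∃ e : V → ℕ, Injective e :=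
    ⟨fun v => Fintype.equivFin V v, Fin.val_injective.comp (Fintype.equivFin V).injective⟩
  refine ⟨Finset.univ.image fun x => exclude e (S x) x, ⟨?_, ?_⟩, ?_, ?_,
    card_image_exclude_le e (fun x => (hS x).trans (hu _)) fun x y hxy => (hun x y hxy).2, ?_⟩
  · intro C hC
    obtain ⟨x, -, rfl⟩ := Finset.mem_image.1 hC
    rintro ⟨l, hl, hl'⟩
    obtain ⟨v, hv, rfl⟩ := mem_exclude.1 hl
    obtain ⟨v', hv', hl⟩ := mem_exclude.1 hl'
    simp only [Literal.neg, Prod.mk.injEq] at hl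
    obtain rfl := he hl.1
    simp at hl
  · intro C hC D hD hne
    obtain ⟨x, -, rfl⟩ := Finset.mem_image.1 hC
    obtain ⟨y, -, rfl⟩ := Finset.mem_image.1 hD
    by_contra hcon
    have hag : ∀ v ∈ S x, v ∈ S y → x v = y v := by
      intro v hx hy
      by_contra hxy
      refine hcon ⟨_, mem_exclude.2 ⟨v, hx, rfl⟩, mem_exclude.2 ⟨v, hy, ?_⟩⟩
      exact Prod.ext rfl (by revert hxy; cases x v <;> cases y v <;> simp [Literal.neg])
    -- Without a conflict, this hybrid input is compatible with both certificates, hence selects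
    -- both.
    have h1 := (hun x (fun v => if v ∈ S x then x v else y v) fun v hv => if_pos hv).2
    have h2 := (hun y (fun v => if v ∈ S x then x v else y v) fun v hv => by
      split_ifs with hx
      · exact hag v hx hv
      · rfl).2
    have h3 : S x = S y := h1.symm.trans h2
    apply hne
    rw [h3]
    refine Finset.image_congr fun v hv => ?_
    rw [hag v (h3 ▸ hv) hv]
  · intro a
    refine ⟨_, Finset.mem_image_of_mem _ (Finset.mem_univ fun v => a (e v)), ?_⟩
    rintro ⟨l, hl, hal⟩
    obtain ⟨v, hv, rfl⟩ := mem_exclude.1 hl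
    simp at hal
  · refine Finset.sup_le fun C hC => ?_
    obtain ⟨x, -, rfl⟩ := Finset.mem_image.1 hC
    exact Finset.card_image_le.trans ((hS x).trans (hu _))
  · intro p
    refine (Nat.pow_le_pow_right (by norm_num) h0).trans
      (p.two_pow_le_size (fun ρ => φ fun v => ρ (e v)) ?_ ?_ (fun _ => none)
        (by simp [Clause.FalsifiedBy]))
    · intro ρ n hn
      by_cases hr : ∃ v, e v = n
      · obtain ⟨v, rfl⟩ := hr
        have : ∀ b, (fun w => update ρ (e v) (some b) (e w)) =
            update (fun w => ρ (e w)) v (some b) := by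
          intro b
          exact Function.update_comp_eq_of_injective ρ he v (some b)
        simp only [this]
        exact hstep _ v hn
      -- A variable outside the formula does not affect the potential.
      · left
        refine ⟨true, le_of_eq (congrArg φ ?_)⟩
        funext v
        rw [update_of_ne fun hv => hr ⟨v, hv⟩]
    · intro ρ hρ C hC hfal
      obtain ⟨x, -, rfl⟩ := Finset.mem_image.1 hC
      obtain ⟨y, hy, hyf⟩ := hend _ hρ (!(f x))
      have : f y = f x := (hun x y fun v hv => hy v _ (by
        simpa using hfal _ (mem_exclude.2 ⟨v, hv, rfl⟩))).1
      rw [hyf] at this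
      simp at this

end Formula

end HittingSep

/-! ### Iteration and choice of parameters -/

namespace HittingSep

open Function Filter

theorem HasCert.mono {V : Type} {f : (V → Bool) → Bool} {c c' : Bool → ℕ} (h : HasCert f c)
    (hc : ∀ b, c b ≤ c' b) : HasCert f c' := fun x =>
  let ⟨S, hS, hy⟩ := h x
  ⟨S, hS.trans (hc _), hy⟩

theorem HasUnamb.mono {V : Type} {f : (V → Bool) → Bool} {u u' : Bool → ℕ} (h : HasUnamb f u)
    (hu : ∀ b, u b ≤ u' b) : HasUnamb f u' :=
  let ⟨S, hS, hy⟩ := h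
  ⟨S, fun x => (hS x).trans (hu _), hy⟩

theorem HasAdversary.canBe {V : Type} [DecidableEq V] {f : (V → Bool) → Bool} {d : ℕ}
    (h : HasAdversary f d) (hd : 0 < d) (b : Bool) : CanBe f (fun _ => none) b :=
  let ⟨_, h0, _, hend⟩ := h
  hend _ (by omega) b

/-- There is a function of at most `N` variables with certificates of size `X` and `n * X` for the
values `false` and `true`, unambiguous certificates of size `n * X`, and query complexity at
least `d`. -/
def Separated (n N X d : ℕ) : Prop :=
  ∃ (V : Type) (_ : Fintype V) (_ : DecidableEq V) (f : (V → Bool) → Bool),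
    Fintype.card V ≤ N ∧ HasCert f (fun b => bif b then n * X else X) ∧
      HasUnamb f (fun _ => n * X) ∧ HasAdversary f d

theorem Separated.mono {n N N' X X' d : ℕ} (h : Separated n N X d) (hN : N ≤ N') (hX : X ≤ X') :
    Separated n N' X' d := by
  obtain ⟨V, hV, hV', f, h1, h2, h3, h4⟩ := h
  have hnX := Nat.mul_le_mul_left n hX
  refine ⟨V, hV, hV', f, h1.trans hN, h2.mono ?_, h3.mono fun _ => hnX, h4⟩
  rintro (_ | _)
  · exact hX
  · exact hnX

theorem separated_one {n : ℕ} (hn : 0 < n) : Separated n 1 1 1 := by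
  refine ⟨Unit, inferInstance, inferInstance, fun x => x (), by simp, fun x => ?_, ?_, ?_⟩
  · refine ⟨Finset.univ, ?_, fun y hy => hy _ (Finset.mem_univ _)⟩
    change 1 ≤ bif x () then n * 1 else 1
    cases x () <;> simp only [cond_true, cond_false] <;> omega
  · refine ⟨fun _ => Finset.univ, fun x => ?_, fun x y hy => ⟨hy _ (Finset.mem_univ _), rfl⟩⟩
    simpa [Nat.one_le_iff_ne_zero, Nat.pos_iff_ne_zero] using hn
  · refine ⟨fun ρ => if ρ () = none then 1 else 0, by simp,
      fun ρ v hv => ⟨true, by dsimp only; split_ifs <;> omega⟩,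
      fun ρ hρ b => ⟨fun _ => b, fun v a hv => ?_, rfl⟩⟩
    have : ρ v = none := by simpa using hρ
    rw [this] at hv
    cases hv

theorem exists_surjective_of_card_le {V : Type} [Fintype V] {L : ℕ}
    (h : Fintype.card V + 1 ≤ 2 ^ L) : ∃ g : (Fin L → Bool) → Option V, Surjective g := by
  classical
  obtain ⟨g⟩ := Function.Embedding.nonempty_of_card_le (α := Option V) (β := Fin L → Bool)
    (by simpa using h)
  exact ⟨invFun g, invFun_surjective g.injective⟩

/-- The first NOR balances the certificates at `n * X` but raises the unambiguous size to order `n ^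
2 * X`. The cheat sheet brings the latter back to about `n * X` for the value `false`. The second
NOR takes `n` certificates of that kind and at most one of the expensive kind, so the unambiguous
size ends at about `n ^ 2 * X`, which is `n` times the new `X`. -/
theorem Separated.step {n N X d c L : ℕ} (h : Separated n N X d) (hd : 0 < d) (hn : 0 < n)
    (hc : 0 < c) (hcd : n * d ≤ 2 ^ c) (hL : n * N + 1 ≤ 2 ^ L) :
    Separated n (n * (c * (n * N) + 2 ^ c * (c * (n * X * L)))) (4 * n * X * (c * (L + 1)))
      (n * (n * d)) := by
  obtain ⟨V, hV, hV', f, h1, h2, h3, h4⟩ := h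
  have hnN := Nat.mul_le_mul_left n h1
  obtain ⟨dec, hdec⟩ := exists_surjective_of_card_le (V := Fin n × V) (L := L) (by
    rw [Fintype.card_prod, Fintype.card_fin]; omega)
  have hcert : HasCert (nor n f) (fun _ => n * X) :=
    (h2.nor n).mono (by rintro (_ | _) <;> exact le_rfl)
  have hnn : n * X ≤ n * (n * X) := Nat.le_mul_of_pos_left _ hn
  have hunamb : HasUnamb (nor n f) (fun _ => 2 * (n * (n * X))) :=
    (h3.nor n).mono (by rintro (_ | _) <;> simp only [cond_true, cond_false] <;> omega)
  have hadv := h4.nor (h4.canBe hd false) n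
  have gcert := hcert.cheat (A := n * X) (fun _ => le_rfl) c (n * X) dec
  have gunamb := hunamb.cheat (fun _ => le_rfl) c (n * X) dec
  have gadv := hadv.cheat (c := c) hcert (fun _ => le_rfl) hc hcd hdec
  let : DecidableEq (CheatVar (Fin n × V) c (n * X) L) := inferInstance
  have hcL : c ≤ c * (L + 1) := Nat.le_mul_of_pos_right _ (Nat.succ_pos _)
  set T := c * (L + 1) with hT
  have e1 : n * X * T ≤ n * (n * X * T) := Nat.le_mul_of_pos_left _ hn
  have e2 : c * (n * X) ≤ n * X * T := by rw [mul_comm c]; exact Nat.mul_le_mul_left _ hcL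
  have e3 : c * (n * (n * X)) ≤ n * (n * X * T) := by
    calc c * (n * (n * X)) = n * (n * X * c) := by ring
      _ ≤ _ := by gcongr
  have e4 : n * (4 * n * X * T) = 4 * (n * (n * X * T)) := by ring
  have e5 : 4 * n * X * T = 4 * (n * X * T) := by ring
  have e6 : c * (2 * (n * (n * X))) = 2 * (c * (n * (n * X))) := by ring
  refine ⟨Fin n × CheatVar (Fin n × V) c (n * X) L, inferInstance, inferInstance, _, ?_,
    (gcert.nor n).mono ?_, (gunamb.nor n).mono ?_,
    gadv.nor (gadv.canBe (Nat.mul_pos hn hd) false) n⟩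
  · simp only [Fintype.card_prod, Fintype.card_sum, Fintype.card_fin, Fintype.card_fun,
      Fintype.card_bool]
    gcongr
  · rintro (_ | _) <;> simp only [cond_true, cond_false] <;> omega
  · rintro (_ | _) <;> simp only [cond_true, cond_false] <;> omega

theorem mul_pow_le_two_pow {a b t : ℕ} (ht : 1 ≤ t) : a * t ^ b ≤ 2 ^ ((a + b) * t) := by
  calc a * t ^ b ≤ 2 ^ (a * t) * (2 ^ t) ^ b :=
        Nat.mul_le_mul ((Nat.lt_two_pow_self (n := a)).le.trans
          (Nat.pow_le_pow_right (by norm_num) (Nat.le_mul_of_pos_right a ht)))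
          (Nat.pow_le_pow_left (Nat.lt_two_pow_self (n := t)).le _)
    _ = 2 ^ ((a + b) * t) := by ring

theorem exists_separated (k : ℕ) : ∃ A : ℕ, ∀ t, 1 ≤ t →
    Separated (2 ^ t) (2 ^ (A * t)) (A * t ^ A * 2 ^ (k * t)) (2 ^ (2 * k * t)) := by
  induction k with
  | zero =>
    refine ⟨1, fun t ht => ?_⟩
    simpa using (separated_one (n := 2 ^ t) (by positivity)).mono Nat.one_le_two_pow ht
  | succ k ih =>
    obtain ⟨A, hA⟩ := ih
    let a := (2 * k + 1) * A * (A + 2)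
    -- The summands are the coefficient of the new certificate bound, the exponents of the two terms
    -- bounding the number of variables, and 1 for adding these terms.
    let A' := 4 * A * (2 * k + 1) * (A + 3) + (2 * k + A + 4) + (a + A + 3 * k + 5) + 1
    refine ⟨A', fun t ht => ?_⟩
    -- This `c` gives exactly `2 ^ c = n * d`, one cell per query to be forced; `L` bits suffice to
    -- name a variable or `none`.
    have h := (hA t ht).step (c := (2 * k + 1) * t) (L := (A + 2) * t) (by positivity)
      (by positivity) (by positivity) (by rw [← pow_add]; apply le_of_eq; ring_nf) (by
        rw [← pow_add]
        calc 2 ^ (t + A * t) + 1 ≤ 2 ^ (t + A * t) + 2 ^ (t + A * t) := by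
              gcongr; exact Nat.one_le_two_pow
          _ = 2 ^ (t + A * t + 1) := by ring
          _ ≤ 2 ^ ((A + 2) * t) := Nat.pow_le_pow_right (by norm_num) (by linarith))
    have hd : 2 ^ t * (2 ^ t * 2 ^ (2 * k * t)) = 2 ^ (2 * (k + 1) * t) := by ring
    rw [hd] at h
    refine h.mono ?_ ?_
    · have f1 : (2 * k + 1) * t ≤ 2 ^ ((2 * k + 2) * t) := by
        simpa using mul_pow_le_two_pow (a := 2 * k + 1) (b := 1) ht
      have f2 : a * t ^ (A + 2) ≤ 2 ^ ((a + (A + 2)) * t) := mul_pow_le_two_pow ht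
      calc 2 ^ t * ((2 * k + 1) * t * (2 ^ t * 2 ^ (A * t)) + 2 ^ ((2 * k + 1) * t) *
            ((2 * k + 1) * t * (2 ^ t * (A * t ^ A * 2 ^ (k * t)) * ((A + 2) * t))))
          = (2 * k + 1) * t * 2 ^ ((A + 2) * t) + (a * t ^ (A + 2)) * 2 ^ ((3 * k + 3) * t) := by
            simp only [a]; ring
        _ ≤ 2 ^ ((2 * k + 2) * t) * 2 ^ ((A + 2) * t) +
            2 ^ ((a + (A + 2)) * t) * 2 ^ ((3 * k + 3) * t) := by gcongr
        _ = 2 ^ ((2 * k + A + 4) * t) + 2 ^ ((a + A + 3 * k + 5) * t) := by ring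
        _ ≤ 2 ^ ((A' - 1) * t) + 2 ^ ((A' - 1) * t) := by
            gcongr ?_ ^ (?_ * t) + ?_ ^ (?_ * t) <;> omega
        _ = 2 ^ ((A' - 1) * t + 1) := by ring
        _ ≤ 2 ^ (A' * t) := by
            apply Nat.pow_le_pow_right (by norm_num)
            have : A' * t = (A' - 1) * t + t := by simp only [A', Nat.add_sub_cancel]; ring
            omega
    · have h3 : (A + 2) * t + 1 ≤ (A + 3) * t := by linarith
      calc 4 * 2 ^ t * (A * t ^ A * 2 ^ (k * t)) * ((2 * k + 1) * t * ((A + 2) * t + 1))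
          ≤ 4 * 2 ^ t * (A * t ^ A * 2 ^ (k * t)) * ((2 * k + 1) * t * ((A + 3) * t)) := by gcongr
        _ = (4 * A * (2 * k + 1) * (A + 3)) * t ^ (A + 2) * 2 ^ ((k + 1) * t) := by ring
        _ ≤ A' * t ^ A' * 2 ^ ((k + 1) * t) := by
            gcongr <;> simp only [A'] <;> omega

theorem Separated.exists_formula {n N X d : ℕ} (h : Separated n N X d) :
    ∃ F : CNF, F.IsHitting ∧ F.Unsatisfiable ∧ F.width ≤ n * X * 2 ∧ F.card ≤ 2 ^ (n * X * 2) ∧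
      ∀ p : TreeRefutation F, 2 ^ d ≤ p.size := by
  obtain ⟨V, hV, hV', f, -, -, h3, h4⟩ := h
  exact HittingSep.exists_formula h3.xorLift (fun _ => le_rfl) h4.xorLift

theorem eventually_mul_pow_le_two_pow (a b : ℕ) : ∀ᶠ t : ℕ in atTop, a * t ^ b ≤ 2 ^ t := by
  have h := tendsto_pow_const_div_const_pow_of_one_lt b (r := (2 : ℝ)) (by norm_num)
  have h2 : ∀ᶠ t : ℕ in atTop, (t : ℝ) ^ b / 2 ^ t < 1 / (a + 1) :=
    h.eventually_lt_const (by positivity)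
  filter_upwards [h2] with t ht
  rw [div_lt_div_iff₀ (by positivity) (by positivity)] at ht
  have : (a : ℝ) * t ^ b ≤ 2 ^ t := by
    have : (0 : ℝ) ≤ (t : ℝ) ^ b := by positivity
    linarith
  exact_mod_cast this

theorem eventually_exists_formula {ε : ℝ} (hε : 0 < ε) : ∀ᶠ m : ℕ in atTop, ∃ F : CNF,
    F.IsHitting ∧ F.Unsatisfiable ∧ F.width ≤ m ∧ F.card ≤ 2 ^ m ∧
      ∀ p : TreeRefutation F, (2 : ℝ) ^ (m : ℝ) ^ (2 - ε) ≤ p.size := by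
  -- This makes `(k + 2) * (2 - ε) < 2 * k`. The 2 in `k + 2`, where `k + 1` is the true exponent of
  -- the width, leaves a factor `2 ^ t` to absorb the polynomial in `t`.
  obtain ⟨k, hk⟩ := exists_nat_gt (4 / ε)
  obtain ⟨A, hA⟩ := exists_separated k
  set β : ℝ := (k + 2) * (2 - ε) with hβdef
  have hβ : 0 < 2 * k - β := by
    rw [div_lt_iff₀ hε] at hk
    rw [hβdef]
    nlinarith
  have hlim : Tendsto (fun m : ℕ => Nat.log 2 m / (k + 2)) atTop atTop :=
    (Nat.tendsto_div_const_atTop (by omega)).comp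
      (tendsto_atTop.2 fun b => eventually_atTop.2
        ⟨2 ^ b, fun m hm => Nat.le_log_of_pow_le (by norm_num) hm⟩)
  filter_upwards [hlim.eventually (eventually_mul_pow_le_two_pow (A * 2) A),
    hlim.eventually (eventually_ge_atTop 1), hlim.eventually (eventually_ge_atTop
      ⌈β / (2 * k - β)⌉₊), eventually_ge_atTop 1] with m h1 h2 h3 hm
  set t := Nat.log 2 m / (k + 2) with ht
  obtain ⟨F, hF1, hF2, hF3, hF4, hF5⟩ := (hA t h2).exists_formula
  have hw : 2 ^ t * (A * t ^ A * 2 ^ (k * t)) * 2 ≤ m := by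
    calc 2 ^ t * (A * t ^ A * 2 ^ (k * t)) * 2 = A * 2 * t ^ A * 2 ^ ((k + 1) * t) := by ring
      _ ≤ 2 ^ t * 2 ^ ((k + 1) * t) := by gcongr
      _ = 2 ^ (t * (k + 2)) := by ring
      _ ≤ 2 ^ Nat.log 2 m := Nat.pow_le_pow_right (by norm_num) (Nat.div_mul_le_self _ _)
      _ ≤ m := Nat.pow_log_le_self 2 (by omega)
  refine ⟨F, hF1, hF2, hF3.trans hw, hF4.trans (Nat.pow_le_pow_right (by norm_num) hw),
    fun p => ?_⟩
  have hmlt : m < 2 ^ ((k + 2) * (t + 1)) :=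
    (Nat.lt_pow_succ_log_self (by norm_num) m).trans_le (Nat.pow_le_pow_right (by norm_num)
      (Nat.lt_mul_div_succ _ (by omega)))
  have hexp : (m : ℝ) ^ (2 - ε) ≤ (2 ^ (2 * k * t) : ℕ) := by
    rcases le_total (2 - ε) 0 with hneg | hpos
    · refine (Real.rpow_le_one_of_one_le_of_nonpos (by exact_mod_cast hm) hneg).trans ?_
      exact_mod_cast Nat.one_le_two_pow
    · have hβt : β * (t + 1) ≤ 2 * k * t := by
        have := (Nat.le_ceil _).trans (Nat.cast_le (α := ℝ).2 h3)
        rw [div_le_iff₀ hβ] at this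
        linarith
      calc (m : ℝ) ^ (2 - ε) ≤ ((2 : ℝ) ^ ((k + 2) * (t + 1))) ^ (2 - ε) :=
            Real.rpow_le_rpow (by positivity) (by exact_mod_cast hmlt.le) hpos
        _ = (2 : ℝ) ^ (β * (t + 1)) := by
            rw [← Real.rpow_natCast, ← Real.rpow_mul (by norm_num), hβdef]
            congr 1
            push_cast
            ring
        _ ≤ (2 : ℝ) ^ (2 * k * t : ℝ) := Real.rpow_le_rpow_of_exponent_le (by norm_num) hβt
        _ = (2 ^ (2 * k * t) : ℕ) := by
            rw [Nat.cast_pow, ← Real.rpow_natCast]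
            push_cast
            rfl
  calc (2 : ℝ) ^ (m : ℝ) ^ (2 - ε) ≤ (2 : ℝ) ^ ((2 ^ (2 * k * t) : ℕ) : ℝ) :=
        Real.rpow_le_rpow_of_exponent_le (by norm_num) hexp
    _ = ((2 ^ (2 ^ (2 * k * t)) : ℕ) : ℝ) := by
        rw [Real.rpow_natCast]; push_cast; rfl
    _ ≤ p.size := by exact_mod_cast hF5 p

theorem TreeRes.one_le_size {F : CNF} {C : Clause} (p : TreeRes F C) : 1 ≤ p.size := by
  cases p <;> simp [TreeRes.size]

theorem isHitting_singleton_empty : CNF.IsHitting {∅} := by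
  simp [CNF.IsHitting, Clause.Conflict]

theorem unsatisfiable_singleton_empty : CNF.Unsatisfiable {∅} := by
  simp [CNF.Unsatisfiable, Clause.SatisfiedBy]

end HittingSep

open HittingSep
theorem mainTheorem2 (ε : ℝ) (hε : 0 < ε) :
    ∃ G : ℕ → CNF,
      -- unsatisfiable hitting formulas
      (∀ m, CNF.IsHitting (G m) ∧ CNF.Unsatisfiable (G m)) ∧
      -- with `2 ^ Õ(m)` clauses
      (∃ g : ℕ → ℝ, TildeO g (fun m => (m : ℝ)) ∧
        ∀ m, ((G m).card : ℝ) ≤ (2 : ℝ) ^ g m) ∧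
      -- of width `Õ(m)`
      TildeO (fun m => (CNF.width (G m) : ℝ)) (fun m => (m : ℝ)) ∧
      -- requiring tree-like resolution size `2 ^ Ω̃(m ^ (2 - ε))`
      (∃ h : ℕ → ℝ, TildeOmega h (fun m => (m : ℝ) ^ (2 - ε)) ∧
        ∀ m, ∀ p : TreeRefutation (G m), (2 : ℝ) ^ h m ≤ (p.size : ℝ)) ∧
      -- quasi-polynomial separation of Hitting from tree-like resolution
      (∃ s : ℕ → ℕ, Filter.Tendsto s Filter.atTop Filter.atTop ∧
        (∀ m, ∃ H : CNF, IsHittingRefutation H (G m) ∧ H.card ≤ s m) ∧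
        ∀ᶠ m in Filter.atTop, ∀ p : TreeRefutation (G m),
          (2 : ℝ) ^ (Real.logb 2 (s m : ℝ)) ^ (2 - ε) ≤ (p.size : ℝ)) := by
  obtain ⟨M, hM⟩ := Filter.eventually_atTop.1 (eventually_exists_formula hε)
  have hG : ∀ m, ∃ F : CNF, (F.IsHitting ∧ F.Unsatisfiable) ∧ F.width ≤ m ∧ F.card ≤ 2 ^ m ∧
      (M ≤ m → ∀ p : TreeRefutation F, (2 : ℝ) ^ (m : ℝ) ^ (2 - ε) ≤ p.size) := by
    intro m
    by_cases hm : M ≤ m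
    · obtain ⟨F, h1, h2, h3, h4, h5⟩ := hM m hm
      exact ⟨F, ⟨h1, h2⟩, h3, h4, fun _ => h5⟩
    · exact ⟨{∅}, ⟨isHitting_singleton_empty, unsatisfiable_singleton_empty⟩,
        by simp [CNF.width], by simpa using Nat.one_le_two_pow, fun h => absurd h hm⟩
  choose G hG hwidth hcard hsize using hG
  refine ⟨G, hG, ⟨fun m => m, ⟨0, ?_⟩, fun m => ?_⟩, ⟨0, ?_⟩,
    ⟨fun m => if M ≤ m then (m : ℝ) ^ (2 - ε) else 0, ⟨0, 1, one_pos, ?_⟩, fun m p => ?_⟩,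
    fun m => 2 ^ m, ?_, fun m => ⟨G m, ⟨(hG m).1, (hG m).2, fun C hC => ⟨C, hC, subset_rfl⟩⟩,
      hcard m⟩, ?_⟩
  · simpa using Asymptotics.isBigO_refl (fun m : ℕ => (m : ℝ)) Filter.atTop
  · rw [Real.rpow_natCast]
    exact_mod_cast hcard m
  · refine Asymptotics.IsBigO.of_bound 1 (Filter.Eventually.of_forall fun m => ?_)
    simpa using hwidth m
  · filter_upwards [Filter.eventually_ge_atTop M] with m hm
    simp [hm]
  · dsimp only
    split_ifs with hm
    · exact hsize m hm p
    · simpa using p.one_le_size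
  · exact tendsto_pow_atTop_atTop_of_one_lt (by norm_num)
  · filter_upwards [Filter.eventually_ge_atTop M] with m hm p
    have : Real.logb 2 ((2 ^ m : ℕ) : ℝ) = m := by
      rw [Nat.cast_pow, Nat.cast_ofNat, Real.logb_pow, Real.logb_self_eq_one (by norm_num), mul_one]
    rw [this]
    exact hsize m hm p
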